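/- Let $G$ be a finite simple graph on $n$ vertices whose complement $\overline{G}$ has exactly $c$ connected components, and let $k$ be an integer with $1\le k\le n-1$. Let $F_k(G)$ be the $k$-token graph of $G$: its vertices are the $k$-element subsets of $V(G)$, and two such subsets $A,B$ are adjacent if and only if their symmetric difference is a pair $\{a,b\}$ with $a\in A$, $b\in B$ and $\{a,b\}\in E(G)$. Then at least $c$ of the eigenvalues of the Laplacian matrix of $F_k(G)$, counted with multiplicity, are integers. If moreover each of the $c$ connected components of $\overline{G}$ has at least $k$ vertices, then at least $\binom{c+k-1}{k}$ of the eigenvalues of the Laplacian matrix of $F_k(G)$, counted with multiplicity, are integers. -/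

import Mathlib

namespace SimpleGraph

/-- The `k`-token graph `F_k(G)` of a graph `G`: its vertices are the `k`-subsets of the vertex set,
and `A`, `B` are adjacent when their symmetric difference is a pair `{a, b}` with `a ∈ A`, `b ∈ B`
and `a`, `b` adjacent in `G`. -/
def tokenGraph {V : Type*} [DecidableEq V] (G : SimpleGraph V) (k : ℕ) :
    SimpleGraph {A : Finset V // A.card = k} where
  Adj A B := ∃ a b : V, a ∈ A.1 ∧ b ∈ B.1 ∧ G.Adj a b ∧ symmDiff A.1 B.1 = {a, b}
  symm := ⟨by
    rintro A B ⟨a, b, ha, hb, hab, h⟩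
    exact ⟨b, a, hb, ha, hab.symm, by rw [symmDiff_comm, h, Finset.pair_comm]⟩⟩
  loopless := ⟨by
    rintro A ⟨a, b, -, -, -, h⟩
    rw [symmDiff_self] at h
    exact (Finset.insert_ne_empty a {b}) h.symm⟩

open Classical in
/-- The number of integer eigenvalues of the Laplacian matrix of a finite graph, counted with
multiplicity. -/
noncomputable def numIntegerLaplacianEigenvalues {W : Type*} [Fintype W]
    (H : SimpleGraph W) : ℕ :=
  ((H.lapMatrix ℝ).charpoly.roots.filter (fun x : ℝ => ∃ m : ℤ, x = (m : ℝ))).card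

end SimpleGraph

/-!
On functions on the `k`-subsets of `V`, the Laplacian of the `k`-token graph of `G` is the sum of
`1 - (a b)` over the edges `ab` of `G`, where the transposition `(a b)` acts by exchanging vertices.
Let `K` be the space of functions invariant under `(a b)` for all edges `ab` of the complement. On `K`
the summands of the non-edges vanish, so the Laplacian of the token graph of `G` acts as that of the
token graph of the complete graph, the Johnson graph (`two_mul_laplacian_tokenGraph`). The latter
commutes with all permutations (`swapLaplacian_top_smul`), hence `K` is invariant.

The Laplacian eigenvalues of the Johnson graph are integers
(`exists_int_of_swapLaplacian_top_eq`): the Laplacian commutes with the operator that lowers functions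
on `(k + 1)`-subsets to functions on `k`-subsets, and on the kernel of that operator it is the scalar
`(k + 1) (n - k)`. As the Laplacian is symmetric, it has at least `dim K` integer eigenvalues,
counted with multiplicity (`finrank_swapInvariant_le`).

The space `K` contains all functions of the profile of a `k`-subset, the multiset of the components of
the complement that its elements lie in. The additive ones among them form a space of dimension `c`
(`card_connectedComponent_le_finrank_swapInvariant`). If every component has at least `k` vertices,
all `k`-multisets of components are profiles, which gives dimension at least `(c + k - 1).choose k`
(`choose_le_finrank_swapInvariant`).
-/

open scoped Pointwise
open Equiv

namespace SimpleGraph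

/-! ### Counting integer eigenvalues by an invariant subspace -/

open Classical in
/-- The Laplacian of a finite graph as an operator on real functions on the vertices. The
decidability instance is internal, so that rewriting never meets a choice of instances. -/
noncomputable def laplacian {W : Type*} [Fintype W] (H : SimpleGraph W) (f : W → ℝ) (A : W) : ℝ :=
  ∑ B, if H.Adj A B then f A - f B else 0

open Classical in
theorem lapMatrix_mulVec_eq_laplacian {W : Type*} [Fintype W] (H : SimpleGraph W) (f : W → ℝ) :
    (H.lapMatrix ℝ).mulVec f = H.laplacian f := by
  funext A
  rw [lapMatrix_mulVec_apply, laplacian, ← Finset.sum_filter, ← neighborFinset_eq_filter,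
    Finset.sum_sub_distrib, Finset.sum_const, card_neighborFinset_eq_degree, nsmul_eq_mul]

open Classical in
/-- If a subspace is invariant under the Laplacian and carries only integer eigenvalues, then its
dimension is a lower bound for the number of integer eigenvalues: an eigenvector in the subspace is
orthogonal to the eigenvectors of all non-integer eigenvalues, so the subspace lies in the span of
the members of an orthonormal eigenbasis that belong to integer eigenvalues. -/
theorem finrank_le_numIntegerLaplacianEigenvalues {W : Type*} [Fintype W] (H : SimpleGraph W)
    (K : Submodule ℝ (W → ℝ)) (hK : ∀ f ∈ K, H.laplacian f ∈ K)
    (hint : ∀ f ∈ K, f ≠ 0 → ∀ μ : ℝ, H.laplacian f = μ • f → ∃ m : ℤ, μ = m) :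
    Module.finrank ℝ K ≤ H.numIntegerLaplacianEigenvalues := by
  simp_rw [← lapMatrix_mulVec_eq_laplacian] at hK hint
  set M := H.lapMatrix ℝ
  have hH : M.IsHermitian := H.isHermitian_lapMatrix (R := ℝ)
  set E := EuclideanSpace ℝ W
  set e : E ≃ₗ[ℝ] (W → ℝ) := WithLp.linearEquiv 2 ℝ (W → ℝ)
  set T : E →ₗ[ℝ] E := Matrix.toEuclideanLin M
  have hTs : T.IsSymmetric := Matrix.isSymmetric_toEuclideanLin_iff.2 hH
  have hTe : ∀ x, e (T x) = M.mulVec (e x) := fun x => rfl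
  set K' : Submodule ℝ E := K.comap e.toLinearMap with hK'
  have hinv : ∀ x ∈ K', T x ∈ K' := fun x hx => hK _ hx
  have hRs := hTs.restrict_invariant hinv
  have hfr : Module.finrank ℝ K' = Module.finrank ℝ K := by
    rw [hK', Submodule.comap_equiv_eq_map_symm]
    exact LinearEquiv.finrank_map_eq _ _
  let b := hRs.eigenvectorBasis rfl
  set S : Finset W := Finset.univ.filter fun i => ∃ m : ℤ, hH.eigenvalues i = m with hS
  -- `b` is an eigenbasis of the subspace: expand each of its members in the eigenbasis of `M`.
  have hle : K' ≤ Submodule.span ℝ (S.image hH.eigenvectorBasis : Set E) := by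
    have hb : ∀ i, (b i : E) ∈ Submodule.span ℝ (S.image hH.eigenvectorBasis : Set E) := by
      intro i
      have hbi := hRs.apply_eigenvectorBasis rfl i
      have hbi' : T (b i) = (hRs.eigenvalues rfl i) • (b i : E) :=
        congrArg Subtype.val hbi
      have hb0 : e (b i) ≠ 0 := by
        have := b.orthonormal.ne_zero i
        simpa using this
      obtain ⟨m, hm⟩ := hint (e (b i)) (b i).2 hb0 (hRs.eigenvalues rfl i) (by
        rw [← hTe, hbi', map_smul])
      rw [← hH.eigenvectorBasis.sum_repr (b i : E)]
      refine Submodule.sum_mem _ fun j _ => ?_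
      by_cases hj : j ∈ S
      · exact Submodule.smul_mem _ _ (Submodule.subset_span (by
          simpa using ⟨j, hj, rfl⟩))
      · rw [hH.eigenvectorBasis.repr_apply_apply]
        have hTj : T (hH.eigenvectorBasis j) = hH.eigenvalues j • hH.eigenvectorBasis j := by
          apply e.injective
          rw [hTe, map_smul]
          exact hH.mulVec_eigenvectorBasis j
        have h1 := hTs (hH.eigenvectorBasis j) (b i)
        rw [hTj, hbi', inner_smul_left, inner_smul_right] at h1
        have hne : hH.eigenvalues j ≠ hRs.eigenvalues rfl i := by
          intro h
          exact hj (by simpa [hS] using ⟨m, h.trans hm⟩)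
        have h2 : inner ℝ (hH.eigenvectorBasis j) (b i : E) = 0 := by
          by_contra h0
          exact hne (mul_right_cancel₀ h0 (by simpa using h1))
        rw [h2, zero_smul]
        exact Submodule.zero_mem _
    intro x hx
    have := congrArg Subtype.val (b.sum_repr ⟨x, hx⟩)
    simp only [Submodule.coe_sum, Submodule.coe_smul] at this
    rw [← this]
    exact Submodule.sum_mem _ fun i _ => Submodule.smul_mem _ _ (hb i)
  calc Module.finrank ℝ K = Module.finrank ℝ K' := hfr.symm
    _ ≤ _ := Submodule.finrank_mono hle
    _ ≤ (S.image hH.eigenvectorBasis).card := finrank_span_finset_le_card _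
    _ ≤ S.card := Finset.card_image_le
    _ = H.numIntegerLaplacianEigenvalues := by
      rw [numIntegerLaplacianEigenvalues, hH.roots_charpoly_eq_eigenvalues, Multiset.filter_map,
        Multiset.card_map]
      rfl

/-! ### The token graph Laplacian as a sum over transpositions -/

section SwapLaplacian

variable {V : Type*} [DecidableEq V]

theorem swap_smul_finset_eq_insert_erase {A : Finset V} {a b : V} (ha : a ∈ A) (hb : b ∉ A) :
    swap a b • A = insert b (A.erase a) := by
  ext x
  rw [← Finset.inv_smul_mem_iff]
  simp only [swap_inv, Perm.smul_def, Finset.mem_insert, Finset.mem_erase]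
  by_cases hxa : x = a
  · subst hxa; rw [swap_apply_left]; grind
  by_cases hxb : x = b
  · subst hxb; rw [swap_apply_right]; grind
  rw [swap_apply_of_ne_of_ne hxa hxb]; grind

theorem swap_smul_finset_eq_self {A : Finset V} {a b : V} (h : a ∈ A ↔ b ∈ A) :
    swap a b • A = A := by
  ext x
  rw [← Finset.inv_smul_mem_iff]
  simp only [swap_inv, Perm.smul_def]
  by_cases hxa : x = a
  · subst hxa; rw [swap_apply_left]; exact h.symm
  by_cases hxb : x = b
  · subst hxb; rw [swap_apply_right]; exact h
  rw [swap_apply_of_ne_of_ne hxa hxb]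

theorem tokenGraph_adj_iff (H : SimpleGraph V) {k : ℕ} {A B : {A : Finset V // A.card = k}} :
    (H.tokenGraph k).Adj A B ↔
      ∃ a b, a ∈ A.1 ∧ b ∉ A.1 ∧ H.Adj a b ∧ swap a b • A.1 = B.1 := by
  constructor
  · rintro ⟨a, b, ha, hb, hab, h⟩
    have hk : A.1.card = B.1.card := A.2.trans B.2.symm
    have hbA : b ∉ A.1 := by
      intro hbA
      have : b ∈ symmDiff A.1 B.1 := by rw [h]; simp
      rw [Finset.mem_symmDiff] at this; tauto
    have haB : a ∉ B.1 := by
      intro hbA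
      have : a ∈ symmDiff A.1 B.1 := by rw [h]; simp
      rw [Finset.mem_symmDiff] at this; tauto
    refine ⟨a, b, ha, hbA, hab, ?_⟩
    rw [swap_smul_finset_eq_insert_erase ha hbA]
    ext x
    have := congrArg (x ∈ ·) h
    simp only [Finset.mem_symmDiff, Finset.mem_insert, Finset.mem_singleton, eq_iff_iff] at this
    grind
  · rintro ⟨a, b, ha, hb, hab, h⟩
    rw [swap_smul_finset_eq_insert_erase ha hb] at h
    refine ⟨a, b, ha, by rw [← h]; simp, hab, ?_⟩
    rw [← h]
    ext x
    simp only [Finset.mem_symmDiff, Finset.mem_insert, Finset.mem_singleton, Finset.mem_erase]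
    grind

variable [Fintype V]

open Classical in
/-- The sum of `1 - (a b)` over the ordered pairs `(a, b)` adjacent in `H`, acting on functions on all
finite subsets through the action of permutations on subsets. On functions on `k`-subsets it is
twice the Laplacian of the `k`-token graph, since each edge is counted in both directions and a
transposition of two elements inside or outside of `A` fixes `A`. -/
noncomputable def swapLaplacian (H : SimpleGraph V) (F : Finset V → ℝ) (A : Finset V) : ℝ :=
  ∑ a, ∑ b, if H.Adj a b then F A - F (swap a b • A) else 0

open Classical in
theorem swapLaplacian_eq_two_mul (H : SimpleGraph V) (F : Finset V → ℝ) (A : Finset V) :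
    H.swapLaplacian F A =
      2 * ∑ a ∈ A, ∑ b ∈ Aᶜ, if H.Adj a b then F A - F (swap a b • A) else 0 := by
  have h0 : ∀ a b, (a ∈ A ↔ b ∈ A) →
      (if H.Adj a b then F A - F (swap a b • A) else 0) = 0 := by
    intro a b h
    rw [swap_smul_finset_eq_self h, sub_self, ite_self]
  have h1 : ∀ a ∈ A, (∑ b, if H.Adj a b then F A - F (swap a b • A) else 0) =
      ∑ b ∈ Aᶜ, if H.Adj a b then F A - F (swap a b • A) else 0 := by
    intro a ha
    rw [← Finset.sum_add_sum_compl A, Finset.sum_eq_zero (s := A), zero_add]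
    exact fun b hb => h0 a b (by tauto)
  have h2 : ∀ a ∈ Aᶜ, (∑ b, if H.Adj a b then F A - F (swap a b • A) else 0) =
      ∑ b ∈ A, if H.Adj a b then F A - F (swap a b • A) else 0 := by
    intro a ha
    rw [← Finset.sum_add_sum_compl A, Finset.sum_eq_zero (s := Aᶜ), add_zero]
    intro b hb
    rw [Finset.mem_compl] at ha hb
    exact h0 a b (by tauto)
  rw [swapLaplacian, ← Finset.sum_add_sum_compl A, Finset.sum_congr rfl h1,
    Finset.sum_congr rfl h2, Finset.sum_comm (s := Aᶜ), two_mul]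
  congr 1
  refine Finset.sum_congr rfl fun a _ => Finset.sum_congr rfl fun b _ => ?_
  rw [swap_comm, H.adj_comm]

open Classical in
theorem two_mul_laplacian_tokenGraph_restrict (H : SimpleGraph V) (F : Finset V → ℝ) {k : ℕ}
    (A : {A : Finset V // A.card = k}) :
    2 * (H.tokenGraph k).laplacian (fun B => F B.1) A = H.swapLaplacian F A.1 := by
  rw [laplacian, swapLaplacian_eq_two_mul, ← Finset.sum_product', ← Finset.sum_filter,
    ← Finset.sum_filter]
  congr 1
  symm
  refine Finset.sum_bij (fun p _ => ⟨swap p.1 p.2 • A.1, by rw [Finset.card_smul_finset, A.2]⟩)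
    ?_ ?_ ?_ ?_
  · rintro ⟨a, b⟩ h
    simp only [Finset.mem_filter, Finset.mem_product, Finset.mem_compl] at h
    simp only [Finset.mem_filter, Finset.mem_univ, true_and, tokenGraph_adj_iff]
    exact ⟨a, b, h.1.1, h.1.2, h.2, rfl⟩
  · rintro ⟨a, b⟩ h ⟨a', b'⟩ h' heq
    simp only [Finset.mem_filter, Finset.mem_product, Finset.mem_compl] at h h'
    rw [Subtype.mk.injEq, swap_smul_finset_eq_insert_erase h.1.1 h.1.2,
      swap_smul_finset_eq_insert_erase h'.1.1 h'.1.2] at heq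
    have ha := congrArg (a ∈ ·) heq
    have hb := congrArg (b ∈ ·) heq
    simp only [Finset.mem_insert, Finset.mem_erase, eq_iff_iff] at ha hb
    grind
  · intro B hB
    simp only [Finset.mem_filter, Finset.mem_univ, true_and, tokenGraph_adj_iff] at hB
    obtain ⟨a, b, ha, hb, hab, h⟩ := hB
    exact ⟨(a, b), by simp [ha, hb, hab], Subtype.ext h⟩
  · intro p _
    rfl

/-! ### Integrality of the Laplacian spectrum of the Johnson graph -/

theorem swapLaplacian_top (F : Finset V → ℝ) (A : Finset V) :
    (⊤ : SimpleGraph V).swapLaplacian F A = ∑ a : V, ∑ b : V, (F A - F (swap a b • A)) := by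
  rw [swapLaplacian]
  refine Finset.sum_congr rfl fun a _ => Finset.sum_congr rfl fun b _ => ?_
  split_ifs with h
  · rfl
  · rw [not_not.1 (mt (top_adj a b).2 h), swap_self, show Equiv.refl V = (1 : Perm V) from rfl,
      one_smul, sub_self]

/-- For the complete graph the operator commutes with all permutations, because conjugation permutes
the transpositions. -/
theorem swapLaplacian_top_smul (F : Finset V → ℝ) (σ : Perm V) (A : Finset V) :
    (⊤ : SimpleGraph V).swapLaplacian (fun B => F (σ • B)) A =
      (⊤ : SimpleGraph V).swapLaplacian F (σ • A) := by
  symm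
  rw [swapLaplacian_top, swapLaplacian_top, ← Equiv.sum_comp σ]
  refine Finset.sum_congr rfl fun a _ => ?_
  rw [← Equiv.sum_comp σ]
  refine Finset.sum_congr rfl fun b _ => ?_
  rw [swap_apply_apply, smul_smul, smul_smul, inv_mul_cancel_right]

/-- The lowering operator, from functions on `(k + 1)`-subsets to functions on `k`-subsets: the value
at `B` is the sum over the sets obtained from `B` by adding one element. -/
def lowering (F : Finset V → ℝ) (B : Finset V) : ℝ := ∑ b ∈ Bᶜ, F (insert b B)

theorem lowering_smul (F : Finset V → ℝ) (σ : Perm V) (B : Finset V) :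
    lowering F (σ • B) = lowering (fun C => F (σ • C)) B := by
  unfold lowering
  symm
  refine Finset.sum_equiv σ (fun b => ?_) fun b _ => ?_
  · rw [Finset.mem_compl, Finset.mem_compl, ← Perm.smul_def, Finset.smul_mem_smul_finset_iff]
  · simp only [Finset.smul_finset_insert, Perm.smul_def]

theorem swapLaplacian_top_lowering (F : Finset V → ℝ) (B : Finset V) :
    (⊤ : SimpleGraph V).swapLaplacian (lowering F) B =
      lowering ((⊤ : SimpleGraph V).swapLaplacian F) B := by
  simp_rw [swapLaplacian_top, lowering_smul, lowering, swapLaplacian_top]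
  rw [Finset.sum_comm]
  simp_rw [Finset.sum_comm (s := Bᶜ), ← Finset.sum_sub_distrib]
  rw [Finset.sum_comm]

theorem swapLaplacian_top_eq_two_mul (F : Finset V → ℝ) (A : Finset V) :
    (⊤ : SimpleGraph V).swapLaplacian F A =
      2 * ∑ a ∈ A, ∑ b ∈ Aᶜ, (F A - F (insert b (A.erase a))) := by
  rw [swapLaplacian_eq_two_mul]
  congr 1
  refine Finset.sum_congr rfl fun a ha => Finset.sum_congr rfl fun b hb => ?_
  rw [Finset.mem_compl] at hb
  rw [swap_smul_finset_eq_insert_erase ha hb, if_pos]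
  rw [top_adj]
  rintro rfl
  exact hb ha

/-- A function on `(k + 1)`-subsets killed by the lowering operator is an eigenvector of the Laplacian
of the Johnson graph, with eigenvalue `(k + 1) (n - k)`. -/
theorem swapLaplacian_top_of_lowering_eq_zero (F : Finset V → ℝ) {k : ℕ}
    (hF : ∀ B : Finset V, B.card = k → lowering F B = 0) {A : Finset V} (hA : A.card = k + 1) :
    (⊤ : SimpleGraph V).swapLaplacian F A =
      2 * ((k + 1) * (Fintype.card V - k)) * F A := by
  have h : ∀ a ∈ A, ∑ b ∈ Aᶜ, (F A - F (insert b (A.erase a))) = (Fintype.card V - k) * F A := by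
    intro a ha
    have hc : (A.erase a).card = k := by rw [Finset.card_erase_of_mem ha, hA]; rfl
    -- The sum defining the lowered function at `A \ {a}` has the term `F A` besides those over `Aᶜ`.
    have h1 := hF _ hc
    rw [lowering, Finset.compl_erase, Finset.sum_insert (by simpa using ha),
      Finset.insert_erase ha] at h1
    have h4 : (Aᶜ.card : ℝ) = Fintype.card V - (k + 1 : ℕ) := by
      rw [← Finset.card_add_card_compl A, hA]; push_cast; ring
    rw [Finset.sum_sub_distrib, Finset.sum_const, nsmul_eq_mul, h4]
    push_cast
    linarith
  rw [swapLaplacian_top_eq_two_mul, Finset.sum_congr rfl h, Finset.sum_const, hA, nsmul_eq_mul]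
  push_cast
  ring

/-- The Laplacian eigenvalues of the Johnson graph are integers: lower an eigenvector until the next
step would kill it; this keeps the eigenvalue. -/
theorem exists_int_of_swapLaplacian_top_eq {k : ℕ} (F : Finset V → ℝ) (μ : ℝ)
    (hF : ∀ A : Finset V, A.card = k → (⊤ : SimpleGraph V).swapLaplacian F A = 2 * μ * F A)
    (h0 : ∃ A : Finset V, A.card = k ∧ F A ≠ 0) : ∃ m : ℤ, μ = m := by
  induction k generalizing F with
  | zero =>
    obtain ⟨A, hA, hFA⟩ := h0
    have h := hF A hA
    rw [Finset.card_eq_zero] at hA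
    subst hA
    refine ⟨0, ?_⟩
    rw [swapLaplacian_top] at h
    simpa [hFA] using h
  | succ k ih =>
    by_cases hD : ∀ B : Finset V, B.card = k → lowering F B = 0
    · obtain ⟨A, hA, hFA⟩ := h0
      have h := (hF A hA).symm.trans (swapLaplacian_top_of_lowering_eq_zero F hD hA)
      refine ⟨(k + 1 : ℕ) * (Fintype.card V - k : ℤ), ?_⟩
      have := mul_right_cancel₀ hFA h
      push_cast at this ⊢
      linarith
    · push Not at hD
      refine ih (lowering F) (fun B hB => ?_) hD
      rw [swapLaplacian_top_lowering, lowering, lowering, Finset.mul_sum]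
      refine Finset.sum_congr rfl fun b hb => hF _ ?_
      rw [Finset.card_insert_of_notMem (by simpa using hb), hB]

end SwapLaplacian

/-! ### Functions invariant under exchanges along edges -/

section SwapInvariant

variable {V : Type*}

/-- Extension of a function on `k`-subsets by zero to all finite subsets, so that permutations act
without carrying proofs about cardinalities. -/
def extendByZero {k : ℕ} (f : {A : Finset V // A.card = k} → ℝ) (A : Finset V) : ℝ :=
  if h : A.card = k then f ⟨A, h⟩ else 0

theorem extendByZero_coe {k : ℕ} (f : {A : Finset V // A.card = k} → ℝ)
    (A : {A : Finset V // A.card = k}) : extendByZero f A.1 = f A :=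
  dif_pos A.2

variable [DecidableEq V]

/-- The functions on `k`-subsets that are invariant under exchanging two vertices adjacent in `H`.
This is the kernel of the Laplacian of the `k`-token graph of `H`. -/
def swapInvariant (H : SimpleGraph V) (k : ℕ) :
    Submodule ℝ ({A : Finset V // A.card = k} → ℝ) where
  carrier := {f | ∀ a b, H.Adj a b → ∀ A B : {A : Finset V // A.card = k},
    B.1 = swap a b • A.1 → f B = f A}
  zero_mem' := fun _ _ _ _ _ _ => rfl
  add_mem' := fun hf hg a b hab A B h => congrArg₂ (· + ·) (hf a b hab A B h) (hg a b hab A B h)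
  smul_mem' := fun c _ hf a b hab A B h => congrArg (c • ·) (hf a b hab A B h)

theorem extendByZero_swap_smul {H : SimpleGraph V} {k : ℕ}
    {f : {A : Finset V // A.card = k} → ℝ} (hf : f ∈ H.swapInvariant k) {a b : V}
    (hab : H.Adj a b) (A : Finset V) : extendByZero f (swap a b • A) = extendByZero f A := by
  unfold extendByZero
  by_cases h : A.card = k
  · rw [dif_pos h, dif_pos (by rwa [Finset.card_smul_finset])]
    exact hf a b hab _ _ rfl
  · rw [dif_neg h, dif_neg (by rwa [Finset.card_smul_finset])]

theorem map_connectedComponentMk_swap_smul (H : SimpleGraph V) {a b : V} (hab : H.Adj a b)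
    (A : Finset V) : (swap a b • A).val.map H.connectedComponentMk =
      A.val.map H.connectedComponentMk := by
  rw [Finset.smul_finset_def, Finset.image_val_of_injOn (MulAction.injective _).injOn,
    Multiset.map_map]
  refine Multiset.map_congr rfl fun v _ => ?_
  have h : H.connectedComponentMk a = H.connectedComponentMk b :=
    ConnectedComponent.sound hab.reachable
  simp only [Function.comp_apply, Perm.smul_def]
  rcases eq_or_ne v a with rfl | hva
  · rw [swap_apply_left, h]
  rcases eq_or_ne v b with rfl | hvb
  · rw [swap_apply_right, h]
  rw [swap_apply_of_ne_of_ne hva hvb]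

/-- The multiset of connected components of `H` met by the elements of a `k`-subset: it records how
many elements lie in each component. -/
def componentProfile (H : SimpleGraph V) (k : ℕ) (A : {A : Finset V // A.card = k}) :
    Sym H.ConnectedComponent k :=
  ⟨A.1.val.map H.connectedComponentMk, by rw [Multiset.card_map]; exact A.2⟩

theorem comp_componentProfile_mem_swapInvariant (H : SimpleGraph V) (k : ℕ)
    (g : Sym H.ConnectedComponent k → ℝ) : g ∘ H.componentProfile k ∈ H.swapInvariant k := by
  intro a b hab A B h
  refine congrArg g (Subtype.ext ?_)
  simp only [componentProfile, h]
  exact H.map_connectedComponentMk_swap_smul hab A.1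

/-! ### The Laplacian of the token graph on invariant functions -/

variable [Fintype V]

open Classical in
theorem swapLaplacian_eq_top (G : SimpleGraph V) {F : Finset V → ℝ}
    (hF : ∀ a b, Gᶜ.Adj a b → ∀ A, F (swap a b • A) = F A) (A : Finset V) :
    G.swapLaplacian F A = (⊤ : SimpleGraph V).swapLaplacian F A := by
  rw [swapLaplacian_top, swapLaplacian]
  refine Finset.sum_congr rfl fun a _ => Finset.sum_congr rfl fun b _ => ?_
  split_ifs with h
  · rfl
  · rcases eq_or_ne a b with rfl | hab
    · rw [swap_self, show Equiv.refl V = (1 : Perm V) from rfl, one_smul, sub_self]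
    · rw [hF a b ((compl_adj _ _ _).2 ⟨hab, h⟩), sub_self]

/-- On functions invariant under the exchanges along non-edges of `G`, the Laplacian of the token
graph of `G` agrees with that of the token graph of the complete graph. -/
theorem two_mul_laplacian_tokenGraph (G : SimpleGraph V) {k : ℕ}
    {f : {A : Finset V // A.card = k} → ℝ} (hf : f ∈ Gᶜ.swapInvariant k)
    (A : {A : Finset V // A.card = k}) :
    2 * (G.tokenGraph k).laplacian f A =
      (⊤ : SimpleGraph V).swapLaplacian (extendByZero f) A.1 := by
  rw [← G.swapLaplacian_eq_top fun a b hab => extendByZero_swap_smul hf hab,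
    ← two_mul_laplacian_tokenGraph_restrict]
  simp_rw [extendByZero_coe]

/-- On the invariant functions the Laplacian of the token graph is that of the Johnson graph: it
preserves them by equivariance, and has integer eigenvalues on them. -/
theorem finrank_swapInvariant_le (G : SimpleGraph V) (k : ℕ) :
    Module.finrank ℝ (Gᶜ.swapInvariant k) ≤
      (G.tokenGraph k).numIntegerLaplacianEigenvalues := by
  refine finrank_le_numIntegerLaplacianEigenvalues _ _ ?_ ?_
  · intro f hf a b hab A B h
    refine mul_left_cancel₀ (two_ne_zero (α := ℝ)) ?_
    rw [two_mul_laplacian_tokenGraph G hf, two_mul_laplacian_tokenGraph G hf, h,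
      ← swapLaplacian_top_smul]
    simp_rw [extendByZero_swap_smul hf hab]
  · intro f hf hf0 μ hμ
    refine exists_int_of_swapLaplacian_top_eq (k := k) (extendByZero f) μ (fun A hA => ?_) ?_
    · have h := two_mul_laplacian_tokenGraph G hf ⟨A, hA⟩
      rw [← h, hμ, Pi.smul_apply, smul_eq_mul, ← extendByZero_coe f, mul_assoc]
    · obtain ⟨A, hA⟩ := Function.ne_iff.1 hf0
      exact ⟨A.1, A.2, by rw [extendByZero_coe]; exact hA⟩

/-! ### The dimension of the space of invariant functions -/

/-- For a function `α` on the components, `A ↦ ∑ v ∈ A, α (component of v)` is invariant. It determines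
`α`: two `k`-subsets that differ in one element show that `α` is constant if the sum vanishes. -/
theorem card_connectedComponent_le_finrank_swapInvariant (H : SimpleGraph V) {k : ℕ} (hk₁ : 1 ≤ k)
    (hk₂ : k ≤ Fintype.card V - 1) :
    Nat.card H.ConnectedComponent ≤ Module.finrank ℝ (H.swapInvariant k) := by
  classical
  let Φ : (H.ConnectedComponent → ℝ) →ₗ[ℝ] H.swapInvariant k :=
    { toFun := fun α => ⟨(fun s : Sym H.ConnectedComponent k => (s.1.map α).sum) ∘
        H.componentProfile k, H.comp_componentProfile_mem_swapInvariant k _⟩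
      map_add' := fun α β => Subtype.ext <| funext fun A => Multiset.sum_map_add
      map_smul' := fun c α => Subtype.ext <| funext fun A => Multiset.sum_map_mul_left }
  have hΦ : ∀ α A, (Φ α).1 A = ∑ v ∈ A.1, α (H.connectedComponentMk v) := fun α A => by
    change ((A.1.val.map H.connectedComponentMk).map α).sum = _
    rw [Multiset.map_map]
    rfl
  have hinj : Function.Injective Φ := by
    rw [injective_iff_map_eq_zero]
    intro α hα
    have h0 : ∀ A : Finset V, A.card = k → ∑ v ∈ A, α (H.connectedComponentMk v) = 0 :=
      fun A hA => by rw [← hΦ α ⟨A, hA⟩, hα]; rfl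
    have hconst : ∀ u v, α (H.connectedComponentMk u) = α (H.connectedComponentMk v) := by
      intro u v
      rcases eq_or_ne u v with rfl | huv
      · rfl
      -- Complete `{u}` and `{v}` to `k`-subsets by the same `k - 1` elements.
      obtain ⟨B, hB, hBk⟩ := Finset.exists_subset_card_eq (s := ({u, v} : Finset V)ᶜ) (n := k - 1)
        (by rw [Finset.card_compl, Finset.card_pair huv]; omega)
      have hu : u ∉ B := fun h => by simpa using hB h
      have hv : v ∉ B := fun h => by simpa using hB h
      have h1 := h0 (insert u B) (by rw [Finset.card_insert_of_notMem hu]; omega)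
      have h2 := h0 (insert v B) (by rw [Finset.card_insert_of_notMem hv]; omega)
      rw [Finset.sum_insert hu] at h1
      rw [Finset.sum_insert hv] at h2
      linarith
    funext C
    induction C using ConnectedComponent.ind with | h u
    obtain ⟨A, -, hA⟩ := Finset.exists_subset_card_eq (s := (Finset.univ : Finset V)) (n := k)
      (by rw [Finset.card_univ]; omega)
    have h := h0 A hA
    rw [Finset.sum_congr rfl fun v _ => hconst v u, Finset.sum_const, hA, nsmul_eq_mul,
      mul_eq_zero, Nat.cast_eq_zero] at h
    exact h.resolve_left (by omega)
  have h := LinearMap.finrank_le_finrank_of_injective hinj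
  rwa [Module.finrank_fintype_fun_eq_card, ← Nat.card_eq_fintype_card] at h

theorem componentProfile_surjective (H : SimpleGraph V) {k : ℕ}
    (hk : ∀ C : H.ConnectedComponent, k ≤ C.supp.ncard) :
    Function.Surjective (H.componentProfile k) := by
  classical
  intro s
  have hT : ∀ C : H.ConnectedComponent, ∃ T ⊆ C.supp.toFinset, T.card = s.1.count C := fun C =>
    Finset.exists_subset_card_eq <| by
      rw [← Set.ncard_eq_toFinset_card']
      exact ((Multiset.count_le_card C s.1).trans_eq s.2).trans (hk C)
  choose T hTs hTc using hT
  let A : Finset V := Finset.univ.filter fun v => v ∈ T (H.connectedComponentMk v)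
  have hmap : A.val.map H.connectedComponentMk = s.1 := by
    ext C
    rw [Multiset.count_map, ← hTc C, ← Finset.filter_val, Finset.card_val]
    congr 1
    ext v
    simp only [A, Finset.mem_filter, Finset.mem_univ, true_and]
    constructor
    · rintro ⟨hv, rfl⟩
      exact hv
    · intro hv
      have : H.connectedComponentMk v = C := by simpa using hTs C hv
      exact ⟨this ▸ hv, this.symm⟩
  refine ⟨⟨A, ?_⟩, Subtype.ext hmap⟩
  rw [← Finset.card_val, ← Multiset.card_map H.connectedComponentMk, hmap]
  exact s.2

/-- If every profile occurs, each function of the profile is an invariant function of its own, and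
profiles are the `k`-multisets of components. -/
theorem choose_le_finrank_swapInvariant (H : SimpleGraph V) {k : ℕ}
    (hk : ∀ C : H.ConnectedComponent, k ≤ C.supp.ncard) :
    (Nat.card H.ConnectedComponent + k - 1).choose k ≤ Module.finrank ℝ (H.swapInvariant k) := by
  classical
  have hinj : Function.Injective ((LinearMap.funLeft ℝ ℝ (H.componentProfile k)).codRestrict
      (H.swapInvariant k) (H.comp_componentProfile_mem_swapInvariant k)) :=
    (LinearMap.injective_codRestrict_iff ..).2 <|
      LinearMap.funLeft_injective_of_surjective ℝ ℝ _ (H.componentProfile_surjective hk)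
  have h := LinearMap.finrank_le_finrank_of_injective hinj
  rwa [Module.finrank_fintype_fun_eq_card, Sym.card_sym_eq_choose,
    ← Nat.card_eq_fintype_card] at h

end SwapInvariant

end SimpleGraph

theorem mainTheorem7 {V : Type*} [Fintype V] [DecidableEq V] (G : SimpleGraph V) (c k : ℕ)
    (hc : Nat.card Gᶜ.ConnectedComponent = c) (hk₁ : 1 ≤ k) (hk₂ : k ≤ Fintype.card V - 1) :
    c ≤ (G.tokenGraph k).numIntegerLaplacianEigenvalues ∧
    ((∀ C : Gᶜ.ConnectedComponent, k ≤ C.supp.ncard) →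
      (c + k - 1).choose k ≤ (G.tokenGraph k).numIntegerLaplacianEigenvalues) := by
  subst hc
  exact ⟨(Gᶜ.card_connectedComponent_le_finrank_swapInvariant hk₁ hk₂).trans
      (G.finrank_swapInvariant_le k),
    fun h => (Gᶜ.choose_le_finrank_swapInvariant h).trans (G.finrank_swapInvariant_le k)⟩
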